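/- Let $A\in\mathbb{R}^{n\times m}$ be the payoff matrix of a zero-sum bimatrix game (the players receive $x^TAy$ and $-x^TAy$ for mixed strategies $x\in\Delta_n$, $y\in\Delta_m$, where $\Delta_k\subset\mathbb{R}^k$ is the probability simplex), let $(x^*,y^*)$ be a Nash equilibrium and $v_A=x^{*T}Ay^*$ the value of the game. Assume that $(x^*,y^*)$ is regular, i.e. $[Ay^*]_i<v_A$ whenever $x^*_i=0$ and $[A^Tx^*]_j>v_A$ whenever $y^*_j=0$. Let $A_*$ be the matrix $A$ with rows restricted to $\mathrm{supp}(x^*)$ and columns restricted to $\mathrm{supp}(y^*)$, and assume that $A_*z\neq 0$ for every nonzero $z\in\mathbb{R}^{\mathrm{supp}(y^*)}$ whose coordinates sum to zero, and $A_*^Tz\neq 0$ for every nonzero $z\in\mathbb{R}^{\mathrm{supp}(x^*)}$ whose coordinates sum to zero. For $h,\epsilon>0$ the CMWU iterates are $(x^{t+1},y^{t+1})=(\varphi_1(x^t,y^t),\varphi_2(x^t,y^t))$, where, with $H_x=A^T\mathrm{diag}(x)A$ and $H_y=A\,\mathrm{diag}(y)A^T$, $$[\varphi_1(x,y)]_i=\frac{x_i\exp(h[Ay]_i-h\epsilon[H_yx]_i)}{\sum_{k=1}^n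 x_k\exp(h[Ay]_k-h\epsilon[H_yx]_k)},\qquad [\varphi_2(x,y)]_j=\frac{y_j\exp(-h[A^Tx]_j-h\epsilon[H_xy]_j)}{\sum_{k=1}^m y_k\exp(-h[A^Tx]_k-h\epsilon[H_xy]_k)}.$$ Then for all $\delta\in[0,1)$ and $C>0$ there is $h_0>0$ such that for every $h\in(0,h_0)$ for which $\epsilon=Ch^{-\delta}$ satisfies $\epsilon<|v_A^{-1}|$ (no condition if $v_A=0$), there is a neighbourhood $U(h)\subset\Delta_n\times\Delta_m$ of $(x^*,y^*)$, relative to $\Delta_n\times\Delta_m$, such that for every $(x^0,y^0)\in U(h)$ the CMWU iterates converge: $\lim_{t\to\infty}(x^t,y^t)=(x^*,y^*)$. -/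

import Mathlib

open Filter Topology Matrix

noncomputable section

namespace CMWU

variable {n m : ℕ}

/-- The payoff `xᵀ A y` of the row player; the column player receives `-xᵀ A y`. -/
def payoff (A : Matrix (Fin n) (Fin m) ℝ) (x : Fin n → ℝ) (y : Fin m → ℝ) : ℝ :=
  x ⬝ᵥ (A *ᵥ y)

/-- Mixed Nash equilibrium of the zero-sum bimatrix game `A`: neither player can increase the
own payoff by a unilateral change of mixed strategy. -/
structure IsNash (A : Matrix (Fin n) (Fin m) ℝ) (x : Fin n → ℝ) (y : Fin m → ℝ) : Prop where
  left_mem : x ∈ stdSimplex ℝ (Fin n)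
  right_mem : y ∈ stdSimplex ℝ (Fin m)
  left_best : ∀ x' ∈ stdSimplex ℝ (Fin n), payoff A x' y ≤ payoff A x y
  right_best : ∀ y' ∈ stdSimplex ℝ (Fin m), -payoff A x y' ≤ -payoff A x y

/-- The payoff is the same at all Nash equilibria, so that the value of the game may be read
off at any one of them. -/
theorem IsNash.payoff_eq {A : Matrix (Fin n) (Fin m) ℝ} {x x' : Fin n → ℝ} {y y' : Fin m → ℝ}
    (h : IsNash A x y) (h' : IsNash A x' y') : payoff A x y = payoff A x' y' := by
  have h1 := h.left_best x' h'.left_mem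
  have h2 := h.right_best y' h'.right_mem
  have h3 := h'.left_best x h.left_mem
  have h4 := h'.right_best y h.right_mem
  linarith

/-- Regular Nash equilibrium: every pure strategy outside the support is strictly worse than
the value of the game for the player who owns it. -/
structure IsRegularNash (A : Matrix (Fin n) (Fin m) ℝ) (x : Fin n → ℝ) (y : Fin m → ℝ) : Prop
    extends IsNash A x y where
  left_strict : ∀ i, x i = 0 → (A *ᵥ y) i < payoff A x y
  right_strict : ∀ j, y j = 0 → payoff A x y < (Aᵀ *ᵥ x) j

/-- The set of indices of the nonzero entries of `z`, as a type. -/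
abbrev Supp {k : ℕ} (z : Fin k → ℝ) : Type := {i : Fin k // z i ≠ 0}

/-- The payoff matrix with rows restricted to `supp x` and columns to `supp y`. -/
def restrict (A : Matrix (Fin n) (Fin m) ℝ) (x : Fin n → ℝ) (y : Fin m → ℝ) :
    Matrix (Supp x) (Supp y) ℝ :=
  A.submatrix Subtype.val Subtype.val

/-- The subspace of vectors whose coordinates sum to zero. -/
def sumZero (ι : Type*) [Fintype ι] : Submodule ℝ (ι → ℝ) where
  carrier := {z | ∑ i, z i = 0}
  zero_mem' := by simp
  add_mem' := by
    intro a b ha hb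
    change ∑ i, a i = 0 at ha
    change ∑ i, b i = 0 at hb
    change ∑ i, (a + b) i = 0
    simp [Finset.sum_add_distrib, ha, hb]
  smul_mem' := by
    intro c a ha
    change ∑ i, a i = 0 at ha
    change ∑ i, (c • a) i = 0
    simp [← Finset.mul_sum, ha]

/-- A possibly non-square matrix `M` is weakly `V`-invertible if `M z ≠ 0` for every nonzero
`z ∈ V`. -/
def WeaklyInvertible {κ ι : Type*} [Fintype ι] (V : Set (ι → ℝ)) (M : Matrix κ ι ℝ) : Prop :=
  ∀ z ∈ V, z ≠ 0 → M *ᵥ z ≠ 0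

/-- The simplex-Hessian `H_x = Aᵀ D_x A`. -/
def hessX (A : Matrix (Fin n) (Fin m) ℝ) (x : Fin n → ℝ) : Matrix (Fin m) (Fin m) ℝ :=
  Aᵀ * diagonal x * A

/-- The simplex-Hessian `H_y = A D_y Aᵀ`. -/
def hessY (A : Matrix (Fin n) (Fin m) ℝ) (y : Fin m → ℝ) : Matrix (Fin n) (Fin n) ℝ :=
  A * diagonal y * Aᵀ

/-- The CMWU update of the row player. -/
def phi₁ (A : Matrix (Fin n) (Fin m) ℝ) (h ε : ℝ) (x : Fin n → ℝ) (y : Fin m → ℝ) :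
    Fin n → ℝ := fun i =>
  x i * Real.exp (h * (A *ᵥ y) i - h * ε * (hessY A y *ᵥ x) i) /
    ∑ k, x k * Real.exp (h * (A *ᵥ y) k - h * ε * (hessY A y *ᵥ x) k)

/-- The CMWU update of the column player. -/
def phi₂ (A : Matrix (Fin n) (Fin m) ℝ) (h ε : ℝ) (x : Fin n → ℝ) (y : Fin m → ℝ) :
    Fin m → ℝ := fun j =>
  y j * Real.exp (-h * (Aᵀ *ᵥ x) j - h * ε * (hessX A x *ᵥ y) j) /
    ∑ k, y k * Real.exp (-h * (Aᵀ *ᵥ x) k - h * ε * (hessX A x *ᵥ y) k)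

/-- The (simultaneous) CMWU update `(x, y) ↦ (φ₁(x, y), φ₂(x, y))`. -/
def step (A : Matrix (Fin n) (Fin m) ℝ) (h ε : ℝ) (p : (Fin n → ℝ) × (Fin m → ℝ)) :
    (Fin n → ℝ) × (Fin m → ℝ) :=
  (phi₁ A h ε p.1 p.2, phi₂ A h ε p.1 p.2)

end CMWU

end

namespace CMWU

/-! Let `v` be the value, `u = x - xs`, `w = y - ys`. The Lyapunov function is `(1 + ε v) KL(xs‖x) +
(1 - ε v) KL(ys‖y)`. A multiplicative-weights step with exponent `g` changes `KL(xs‖x)` by `log ∑ x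
exp g - xs ⬝ᵥ g`, which is expanded to second order at the equilibrium
(`RegularPair.exists_log_sum_exp_bound`).

The first-order coupling is `h (1 - ε v) uᵀAw` for the row player and `-h (1 + ε v) uᵀAw` for the
column player, so the two weights are exactly what cancels it; `ε < |v⁻¹|` makes both weights
positive. The Hessian terms contribute `-h ε Y` and `-h ε X` with `Y = ∑ ys (Aᵀu)²` and `X = ∑ xs
(Aw)²`. The second-order terms of the exponential are of size `h²` and `(h ε)²` times `X` and `Y`,
hence dominated when both `h ε` and `h / ε` are small; for `ε = C h ^ (-δ)` with `δ < 1` this is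
smallness of `h`.

By regularity, off-support coordinates have a strictly negative limiting centred exponent, which
gives a decrease linear in the off-support mass. Weak invertibility bounds the squared distance to
the equilibrium by a multiple of `X + Y` plus that mass (`WeaklyInvertible.exists_coercive`). All
remaining errors are smaller by a factor of the distance, so the Lyapunov function drops by a
multiple of the squared distance at each step. -/

/-! ### Discrete Lyapunov stability. -/

/-- Asymptotic stability from a Lyapunov function that dominates, and decreases by, a multiple of
the squared distance to the fixed point. -/
theorem exists_basin_of_quadratic_lyapunov {E : Type*} [PseudoMetricSpace E] {f : E → E}
    {S : Set E} {p : E} {V : E → ℝ} {c μ : ℝ} (hc : 0 < c) (hμ : 0 < μ)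
    (hmaps : Set.MapsTo f S S) (hV : ∀ q ∈ S, c * dist q p ^ 2 ≤ V q)
    (hlim : Tendsto V (𝓝[S] p) (𝓝 0))
    (hdec : ∀ᶠ q in 𝓝[S] p, V (f q) ≤ V q - μ * dist q p ^ 2) :
    ∃ U ⊆ S, U ∈ 𝓝[S] p ∧ ∀ q ∈ U, Tendsto (fun t : ℕ => f^[t] q) atTop (𝓝 p) := by
  obtain ⟨ρ, hρ, hball⟩ := Metric.mem_nhdsWithin_iff.1 hdec
  -- The level `c * ρ ^ 2` forces the sublevel set into the ball of radius `ρ` on which the decrease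
  -- holds, so the set is invariant.
  refine ⟨{q | q ∈ S ∧ V q < c * ρ ^ 2}, fun q hq => hq.1, ?_, ?_⟩
  · filter_upwards [self_mem_nhdsWithin, hlim.eventually (gt_mem_nhds (show 0 < c * ρ ^ 2 by positivity))]
      with q h1 h2 using ⟨h1, h2⟩
  intro q hq
  have hstep : ∀ q', q' ∈ S ∧ V q' < c * ρ ^ 2 → V (f q') ≤ V q' - μ * dist q' p ^ 2 := by
    intro q' h'
    refine hball ⟨?_, h'.1⟩
    have : dist q' p ^ 2 < ρ ^ 2 := lt_of_mul_lt_mul_left ((hV q' h'.1).trans_lt h'.2) hc.le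
    exact lt_of_pow_lt_pow_left₀ 2 hρ.le this
  have hmem : ∀ t : ℕ, f^[t] q ∈ S ∧ V (f^[t] q) < c * ρ ^ 2 := by
    intro t
    induction t with
    | zero => exact hq
    | succ t ih =>
      rw [Function.iterate_succ_apply']
      refine ⟨hmaps ih.1, (hstep _ ih).trans_lt ?_⟩
      have : 0 ≤ μ * dist (f^[t] q) p ^ 2 := by positivity
      linarith [ih.2]
  -- Telescoping the decrease makes the squared distances summable, hence convergent to zero.
  have hsum : ∀ t : ℕ, ∑ s ∈ Finset.range t, μ * dist (f^[s] q) p ^ 2 ≤ V q - V (f^[t] q) := by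
    intro t
    induction t with
    | zero => simp
    | succ t ih =>
      rw [Finset.sum_range_succ, Function.iterate_succ_apply']
      linarith [hstep _ (hmem t)]
  have hsummable : Summable fun s : ℕ => μ * dist (f^[s] q) p ^ 2 := by
    refine summable_of_sum_range_le (c := V q) (fun s => by positivity) fun t => ?_
    have h0 : 0 ≤ V (f^[t] q) := le_trans (by positivity) (hV _ (hmem t).1)
    linarith [hsum t]
  rw [tendsto_iff_dist_tendsto_zero]
  have h := (hsummable.tendsto_atTop_zero.const_mul μ⁻¹).sqrt
  simpa [← mul_assoc, hμ.ne', Real.sqrt_sq] using h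

/-! ### Relative entropy. -/

/-- The Kullback–Leibler divergence of `x` from the reference point `z`. -/
noncomputable def relEnt {ι : Type*} [Fintype ι] (z x : ι → ℝ) : ℝ :=
  ∑ i, z i * (Real.log (z i) - Real.log (x i))

/-- Comparison with the Hellinger distance: `log t ≤ t - 1` at `t = √(x i / z i)` bounds the entropy
below by `∑ (√x - √z)²`, and `√x + √z ≤ 2` on the simplex. The positivity hypothesis excludes the
junk value `Real.log 0 = 0`. -/
theorem relEnt_ge {ι : Type*} [Fintype ι] {z x : ι → ℝ} (hz : z ∈ stdSimplex ℝ ι)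
    (hx : x ∈ stdSimplex ℝ ι) (hpos : ∀ i, z i ≠ 0 → 0 < x i) (i : ι) :
    (x i - z i) ^ 2 / 4 ≤ relEnt z x := by
  have hterm : ∀ i, 2 * z i - 2 * (√(z i) * √(x i)) ≤ z i * (Real.log (z i) - Real.log (x i)) := by
    intro i
    rcases eq_or_ne (z i) 0 with h0 | h0
    · simp [h0]
    have hzi : 0 < z i := lt_of_le_of_ne (hz.1 i) h0.symm
    have hxi := hpos i h0
    have h1 := Real.log_le_sub_one_of_pos (show 0 < √(x i) / √(z i) by positivity)
    rw [Real.log_div (by positivity) (by positivity), Real.log_sqrt hxi.le,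
      Real.log_sqrt hzi.le] at h1
    have h2 : z i * (√(x i) / √(z i)) = √(z i) * √(x i) := by
      field_simp
      rw [Real.sq_sqrt hzi.le]
    nlinarith
  have hsum : ∑ i, (√(x i) - √(z i)) ^ 2 ≤ relEnt z x := by
    have h1 : ∑ i, (√(x i) - √(z i)) ^ 2 = ∑ i, (2 * z i - 2 * (√(z i) * √(x i))) := by
      have h2 : ∑ i, (√(x i) - √(z i)) ^ 2
          = ∑ i, ((2 * z i - 2 * (√(z i) * √(x i))) + (x i - z i)) :=
        Finset.sum_congr rfl fun i _ => by
          have e1 := Real.sq_sqrt (hx.1 i)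
          have e2 := Real.sq_sqrt (hz.1 i)
          linear_combination e1 + e2
      rw [h2, Finset.sum_add_distrib, Finset.sum_sub_distrib x z, hx.2, hz.2]
      ring
    rw [h1]
    exact Finset.sum_le_sum fun i _ => hterm i
  have hle : ∀ w ∈ stdSimplex ℝ ι, √(w i) ≤ 1 := fun w hw => by
    rw [Real.sqrt_le_iff]
    refine ⟨zero_le_one, ?_⟩
    rw [one_pow, ← hw.2]
    exact Finset.single_le_sum (fun j _ => hw.1 j) (Finset.mem_univ i)
  have hi : (√(x i) - √(z i)) ^ 2 ≤ relEnt z x :=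
    (Finset.single_le_sum (f := fun i => (√(x i) - √(z i)) ^ 2) (fun j _ => sq_nonneg _)
      (Finset.mem_univ i)).trans hsum
  have e : x i - z i = (√(x i) - √(z i)) * (√(x i) + √(z i)) := by
    linear_combination -(Real.sq_sqrt (hx.1 i)) + Real.sq_sqrt (hz.1 i)
  have hs : (√(x i) + √(z i)) ^ 2 ≤ 4 := by
    nlinarith [hle x hx, hle z hz, Real.sqrt_nonneg (x i), Real.sqrt_nonneg (z i)]
  rw [e, mul_pow]
  nlinarith [sq_nonneg (√(x i) - √(z i))]

theorem norm_sub_sq_le_relEnt {ι : Type*} [Fintype ι] {z x : ι → ℝ} (hz : z ∈ stdSimplex ℝ ι)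
    (hx : x ∈ stdSimplex ℝ ι) (hpos : ∀ i, z i ≠ 0 → 0 < x i) :
    ‖x - z‖ ^ 2 / 4 ≤ relEnt z x := by
  have hne : Nonempty ι := by
    by_contra h
    rw [not_nonempty_iff] at h
    simpa using hz.2
  obtain ⟨i, hi⟩ := Finite.exists_max fun i => ‖(x - z) i‖
  have h1 : ‖x - z‖ ≤ ‖(x - z) i‖ := (pi_norm_le_iff_of_nonneg (norm_nonneg _)).2 hi
  have h2 := relEnt_ge hz hx hpos i
  have h3 : ‖x - z‖ ^ 2 ≤ (x i - z i) ^ 2 := by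
    rw [← sq_abs (x i - z i)]
    exact pow_le_pow_left₀ (norm_nonneg _) h1 2
  linarith

theorem continuousAt_relEnt {ι : Type*} [Fintype ι] (z : ι → ℝ) :
    ContinuousAt (relEnt z) z := by
  unfold relEnt
  refine tendsto_finsetSum _ fun i _ => ?_
  have hi : ContinuousAt (fun x : ι → ℝ => x i) z := continuousAt_apply i z
  rcases eq_or_ne (z i) 0 with h | h
  · simp [h]
  · exact ((continuousAt_const (y := Real.log (z i))).sub (hi.log h)).const_mul (z i)

@[simp] theorem relEnt_self {ι : Type*} [Fintype ι] (z : ι → ℝ) : relEnt z z = 0 := by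
  simp [relEnt]

/-! ### Exponential weights. -/

/-- The exponentially weighted point `x`, normalised to the simplex. -/
noncomputable def expWeight {ι : Type*} [Fintype ι] (g x : ι → ℝ) : ι → ℝ := fun i =>
  x i * Real.exp (g i) / ∑ k, x k * Real.exp (g k)

theorem sum_mul_exp_pos {ι : Type*} [Fintype ι] {x : ι → ℝ} (hx : x ∈ stdSimplex ℝ ι)
    (g : ι → ℝ) : 0 < ∑ k, x k * Real.exp (g k) := by
  refine Finset.sum_pos' (fun i _ => mul_nonneg (hx.1 i) (Real.exp_pos _).le) ?_
  by_contra! h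
  have h0 : ∀ i, x i = 0 := fun i => by
    have h1 := h i (Finset.mem_univ i)
    exact le_antisymm (nonpos_of_mul_nonpos_left h1 (Real.exp_pos _)) (hx.1 i)
  have := hx.2
  simp [h0] at this

theorem expWeight_mem {ι : Type*} [Fintype ι] {x : ι → ℝ} (hx : x ∈ stdSimplex ℝ ι)
    (g : ι → ℝ) : expWeight g x ∈ stdSimplex ℝ ι := by
  have h := sum_mul_exp_pos hx g
  refine ⟨fun i => div_nonneg (mul_nonneg (hx.1 i) (Real.exp_pos _).le) h.le, ?_⟩
  simp only [expWeight]
  rw [← Finset.sum_div, div_self h.ne']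

theorem expWeight_pos {ι : Type*} [Fintype ι] {x : ι → ℝ} (hx : x ∈ stdSimplex ℝ ι)
    (g : ι → ℝ) {i : ι} (hi : 0 < x i) : 0 < expWeight g x i :=
  div_pos (mul_pos hi (Real.exp_pos _)) (sum_mul_exp_pos hx g)

theorem relEnt_expWeight {ι : Type*} [Fintype ι] {z x : ι → ℝ} (hz : z ∈ stdSimplex ℝ ι)
    (hx : x ∈ stdSimplex ℝ ι) (hpos : ∀ i, z i ≠ 0 → 0 < x i) (g : ι → ℝ) :
    relEnt z (expWeight g x) =
      relEnt z x + (Real.log (∑ k, x k * Real.exp (g k)) - z ⬝ᵥ g) := by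
  have hZ := sum_mul_exp_pos hx g
  have h : ∀ i, z i * (Real.log (z i) - Real.log (expWeight g x i)) =
      z i * (Real.log (z i) - Real.log (x i)) - z i * g i
        + z i * Real.log (∑ k, x k * Real.exp (g k)) := by
    intro i
    rcases eq_or_ne (z i) 0 with h0 | h0
    · simp [h0]
    have := hpos i h0
    rw [expWeight, Real.log_div (by positivity) hZ.ne', Real.log_mul this.ne' (by positivity),
      Real.log_exp]
    ring
  simp only [relEnt, h, Finset.sum_add_distrib, Finset.sum_sub_distrib, ← Finset.sum_mul, hz.2,
    dotProduct]
  ring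

/-- This is `log t ≤ t - 1` after factoring out `exp c`. Centring at `c = xs ⬝ᵥ g` will make the
first-order part of the right-hand side vanish against `xs`. -/
theorem log_sum_mul_exp_sub_le {ι : Type*} [Fintype ι] {x : ι → ℝ}
    (hx : x ∈ stdSimplex ℝ ι) (g : ι → ℝ) (c : ℝ) :
    Real.log (∑ k, x k * Real.exp (g k)) - c ≤ ∑ k, x k * (Real.exp (g k - c) - 1) := by
  have h := sum_mul_exp_pos hx g
  have h1 : Real.log ((∑ k, x k * Real.exp (g k)) * Real.exp (-c)) =
      Real.log (∑ k, x k * Real.exp (g k)) - c := by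
    rw [Real.log_mul h.ne' (by positivity), Real.log_exp]
    ring
  rw [← h1]
  refine (Real.log_le_sub_one_of_pos (by positivity)).trans_eq ?_
  simp only [mul_one, hx.2, sub_eq_add_neg, Real.exp_add,
    ← mul_assoc, Finset.sum_mul, mul_add, Finset.sum_add_distrib, mul_neg, Finset.sum_neg_distrib]

/-! ### Complementary slackness and the symmetry between the players. -/

theorem payoff_eq_transpose {n m : ℕ} (A : Matrix (Fin n) (Fin m) ℝ) (x : Fin n → ℝ)
    (y : Fin m → ℝ) : payoff A x y = (Aᵀ *ᵥ x) ⬝ᵥ y := by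
  rw [payoff, dotProduct_mulVec, mulVec_transpose]

/-- The complementary-slackness form of a regular equilibrium of value `v`. -/
structure RegularPair {n m : ℕ} (A : Matrix (Fin n) (Fin m) ℝ) (x : Fin n → ℝ) (y : Fin m → ℝ)
    (v : ℝ) : Prop where
  left_mem : x ∈ stdSimplex ℝ (Fin n)
  right_mem : y ∈ stdSimplex ℝ (Fin m)
  row_eq : ∀ i, x i ≠ 0 → (A *ᵥ y) i = v
  row_lt : ∀ i, x i = 0 → (A *ᵥ y) i < v
  col_eq : ∀ j, y j ≠ 0 → (Aᵀ *ᵥ x) j = v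
  col_gt : ∀ j, y j = 0 → v < (Aᵀ *ᵥ x) j

theorem eq_of_sum_mul_eq {ι : Type*} [Fintype ι] {x a : ι → ℝ} {v : ℝ}
    (hx : x ∈ stdSimplex ℝ ι) (ha : ∀ i, a i ≤ v) (h : ∑ i, x i * a i = v) (i : ι)
    (hi : x i ≠ 0) : a i = v := by
  have h0 : ∑ i, x i * (v - a i) = 0 := by
    simp only [mul_sub, Finset.sum_sub_distrib, ← Finset.sum_mul, hx.2, h]
    ring
  have h1 := (Finset.sum_eq_zero_iff_of_nonneg fun i _ =>
    mul_nonneg (hx.1 i) (sub_nonneg.2 (ha i))).1 h0 i (Finset.mem_univ i)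
  linarith [(mul_eq_zero.1 h1).resolve_left hi]

theorem IsRegularNash.regularPair {n m : ℕ} {A : Matrix (Fin n) (Fin m) ℝ} {x : Fin n → ℝ}
    {y : Fin m → ℝ} (h : IsRegularNash A x y) : RegularPair A x y (payoff A x y) where
  left_mem := h.left_mem
  right_mem := h.right_mem
  row_lt := h.left_strict
  col_gt := h.right_strict
  row_eq := by
    refine eq_of_sum_mul_eq h.left_mem (fun i => ?_) rfl
    simpa [payoff] using h.left_best _ (single_mem_stdSimplex ℝ i)
  col_eq := fun j hj => by
    have h1 := eq_of_sum_mul_eq (a := -(Aᵀ *ᵥ x)) (v := -payoff A x y) h.right_mem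
      (fun j => ?_) ?_ j hj
    · simpa using h1
    · have h2 := h.right_best _ (single_mem_stdSimplex ℝ j)
      rw [payoff_eq_transpose A x (Pi.single j 1)] at h2
      simpa using h2
    · rw [payoff_eq_transpose, dotProduct_comm]
      simp [dotProduct]

/-- The column player is the row player of the game `-Aᵀ` with value `-v`, so each estimate is
needed for one player only. The Hessian term is quadratic in the matrix and keeps its sign. -/
theorem RegularPair.symm {n m : ℕ} {A : Matrix (Fin n) (Fin m) ℝ} {x : Fin n → ℝ}
    {y : Fin m → ℝ} {v : ℝ} (h : RegularPair A x y v) : RegularPair (-Aᵀ) y x (-v) where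
  left_mem := h.right_mem
  right_mem := h.left_mem
  row_eq := fun j hj => by simpa [neg_mulVec] using h.col_eq j hj
  row_lt := fun j hj => by simpa [neg_mulVec] using h.col_gt j hj
  col_eq := fun i hi => by simpa [neg_mulVec] using h.row_eq i hi
  col_gt := fun i hi => by simpa [neg_mulVec] using h.row_lt i hi

/-! ### Linearisation of the exponent. -/

/-- The exponent of the row player's update. -/
noncomputable def exponent {n m : ℕ} (A : Matrix (Fin n) (Fin m) ℝ) (h ε : ℝ) (x : Fin n → ℝ)
    (y : Fin m → ℝ) : Fin n → ℝ :=
  h • (A *ᵥ y) - (h * ε) • (A *ᵥ (y * (Aᵀ *ᵥ x)))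

theorem hessY_mulVec {n m : ℕ} (A : Matrix (Fin n) (Fin m) ℝ) (x : Fin n → ℝ)
    (y : Fin m → ℝ) : hessY A y *ᵥ x = A *ᵥ (y * (Aᵀ *ᵥ x)) := by
  rw [hessY, ← mulVec_mulVec, ← mulVec_mulVec]
  congr 1
  ext j
  simp [mulVec_diagonal]

theorem phi₁_eq {n m : ℕ} (A : Matrix (Fin n) (Fin m) ℝ) (h ε : ℝ) (x : Fin n → ℝ)
    (y : Fin m → ℝ) : phi₁ A h ε x y = expWeight (exponent A h ε x y) x := by
  funext i
  simp [phi₁, expWeight, exponent, hessY_mulVec]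

theorem phi₂_eq {n m : ℕ} (A : Matrix (Fin n) (Fin m) ℝ) (h ε : ℝ) (x : Fin n → ℝ)
    (y : Fin m → ℝ) : phi₂ A h ε x y = expWeight (exponent (-Aᵀ) h ε y x) y := by
  rw [← phi₁_eq]
  funext j
  have : hessY (-Aᵀ) x = hessX A x := by simp [hessY, hessX]
  simp [phi₁, phi₂, this, neg_mulVec]

/-- The linearisation of the row player's exponent at an equilibrium of value `v`, up to terms
controlled by the mass outside the support. -/
noncomputable def linExponent {n m : ℕ} (A : Matrix (Fin n) (Fin m) ℝ) (h ε v : ℝ)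
    (ys : Fin m → ℝ) (u : Fin n → ℝ) (w : Fin m → ℝ) : Fin n → ℝ :=
  (h * (1 - ε * v)) • (A *ᵥ w) - (h * ε) • (A *ᵥ (ys * (Aᵀ *ᵥ u)))

/-- Since `Aᵀ xs = v` on the support of `ys`, the Hessian term has leading part `v • A y`; this is
the source of the factor `1 - ε v`. In the last term, `Aᵀ xs - v` vanishes on the support and the
other product is quadratic. -/
theorem RegularPair.exponent_eq {n m : ℕ} {A : Matrix (Fin n) (Fin m) ℝ} {xs : Fin n → ℝ}
    {ys : Fin m → ℝ} {v : ℝ} (hR : RegularPair A xs ys v) (h ε : ℝ) (x : Fin n → ℝ)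
    (y : Fin m → ℝ) :
    exponent A h ε x y = (h * (1 - ε * v)) • (A *ᵥ ys)
      + linExponent A h ε v ys (x - xs) (y - ys)
      - (h * ε) • (A *ᵥ ((y - ys) * (((Aᵀ *ᵥ xs) - fun _ => v) + Aᵀ *ᵥ (x - xs)))) := by
  have h1 : y * (Aᵀ *ᵥ x) = v • ys + v • (y - ys) + ys * (Aᵀ *ᵥ (x - xs))
      + (y - ys) * (((Aᵀ *ᵥ xs) - fun _ => v) + Aᵀ *ᵥ (x - xs)) := by
    funext j
    have h2 : ys j * (Aᵀ *ᵥ xs) j = v * ys j := by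
      rcases eq_or_ne (ys j) 0 with h0 | h0
      · simp [h0]
      · rw [hR.col_eq j h0, mul_comm]
    simp only [mulVec_sub, Pi.add_apply, Pi.mul_apply, Pi.sub_apply, Pi.smul_apply, smul_eq_mul]
    linear_combination h2
  rw [exponent, h1, linExponent]
  funext k
  simp only [mulVec_add, mulVec_smul, mulVec_sub, Pi.add_apply, Pi.sub_apply, Pi.smul_apply,
    smul_eq_mul]
  ring

/-! ### Matrix bounds and the quadratic forms. -/

/-- The entrywise `ℓ¹` norm. -/
noncomputable def absSum {n m : ℕ} (A : Matrix (Fin n) (Fin m) ℝ) : ℝ := ∑ i, ∑ j, |A i j|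

theorem absSum_nonneg {n m : ℕ} (A : Matrix (Fin n) (Fin m) ℝ) : 0 ≤ absSum A :=
  Finset.sum_nonneg fun _ _ => Finset.sum_nonneg fun _ _ => abs_nonneg _

theorem absSum_transpose {n m : ℕ} (A : Matrix (Fin n) (Fin m) ℝ) : absSum Aᵀ = absSum A :=
  Finset.sum_comm

theorem absSum_neg {n m : ℕ} (A : Matrix (Fin n) (Fin m) ℝ) : absSum (-A) = absSum A := by
  simp [absSum]

theorem abs_le_absSum {n m : ℕ} (A : Matrix (Fin n) (Fin m) ℝ) (i : Fin n) (j : Fin m) :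
    |A i j| ≤ absSum A :=
  (Finset.single_le_sum (f := fun j => |A i j|) (fun _ _ => abs_nonneg _)
    (Finset.mem_univ j)).trans
  (Finset.single_le_sum (f := fun i => ∑ j, |A i j|)
    (fun _ _ => Finset.sum_nonneg fun _ _ => abs_nonneg _) (Finset.mem_univ i))

theorem abs_dotProduct_le {ι : Type*} [Fintype ι] (a w : ι → ℝ) {r : ℝ}
    (hw : ∀ j, a j ≠ 0 → |w j| ≤ r) : |a ⬝ᵥ w| ≤ (∑ j, |a j|) * r := by
  rw [dotProduct, Finset.sum_mul]
  refine (Finset.abs_sum_le_sum_abs _ _).trans (Finset.sum_le_sum fun j _ => ?_)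
  rw [abs_mul]
  rcases eq_or_ne (a j) 0 with h | h
  · simp [h]
  · exact mul_le_mul_of_nonneg_left (hw j h) (abs_nonneg _)

theorem abs_mulVec_le {n m : ℕ} (A : Matrix (Fin n) (Fin m) ℝ) {w : Fin m → ℝ} {r : ℝ}
    (hr : 0 ≤ r) (hw : ∀ j, |w j| ≤ r) (i : Fin n) : |(A *ᵥ w) i| ≤ absSum A * r := by
  refine (abs_dotProduct_le (A i) w fun j _ => hw j).trans (mul_le_mul_of_nonneg_right ?_ hr)
  exact Finset.single_le_sum (f := fun i => ∑ j, |A i j|)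
    (fun _ _ => Finset.sum_nonneg fun _ _ => abs_nonneg _) (Finset.mem_univ i)

/-- Jensen's inequality for the square on the simplex. -/
theorem sq_sum_mul_le {ι : Type*} [Fintype ι] {y : ι → ℝ} (hy : ∀ i, 0 ≤ y i) (a b : ι → ℝ)
    {S : ℝ} (hS : ∀ i, |a i| ≤ S) (h1 : ∑ i, y i = 1) :
    (∑ i, a i * (y i * b i)) ^ 2 ≤ S ^ 2 * ∑ i, y i * b i ^ 2 := by
  have h := Finset.sum_sq_le_sum_mul_sum_of_sq_le_mul Finset.univ
    (r := fun i => a i * (y i * b i)) (f := fun i => y i * a i ^ 2) (g := fun i => y i * b i ^ 2)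
    (fun i _ => mul_nonneg (hy i) (sq_nonneg _)) (fun i _ => mul_nonneg (hy i) (sq_nonneg _))
    (fun i _ => le_of_eq (by ring))
  refine h.trans (mul_le_mul_of_nonneg_right ?_
    (Finset.sum_nonneg fun i _ => mul_nonneg (hy i) (sq_nonneg _)))
  calc ∑ i, y i * a i ^ 2 ≤ ∑ i, y i * S ^ 2 :=
        Finset.sum_le_sum fun i _ => mul_le_mul_of_nonneg_left
          (sq_le_sq' (abs_le.1 (hS i)).1 (abs_le.1 (hS i)).2) (hy i)
    _ = S ^ 2 := by rw [← Finset.sum_mul, h1, one_mul]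

theorem sum_linExponent_sq_le {n m : ℕ} (A : Matrix (Fin n) (Fin m) ℝ) (h ε v : ℝ)
    {xs : Fin n → ℝ} {ys : Fin m → ℝ} (hx : xs ∈ stdSimplex ℝ (Fin n))
    (hy : ys ∈ stdSimplex ℝ (Fin m)) (u : Fin n → ℝ) (w : Fin m → ℝ) :
    ∑ k, xs k * linExponent A h ε v ys u w k ^ 2 ≤
      2 * (h * (1 - ε * v)) ^ 2 * ∑ k, xs k * (A *ᵥ w) k ^ 2
        + 2 * (h * ε) ^ 2 * (absSum A ^ 2 * ∑ j, ys j * (Aᵀ *ᵥ u) j ^ 2) := by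
  have h1 : ∀ k, xs k * linExponent A h ε v ys u w k ^ 2 ≤
      2 * (h * (1 - ε * v)) ^ 2 * (xs k * (A *ᵥ w) k ^ 2)
        + xs k * (2 * (h * ε) ^ 2 * (absSum A ^ 2 * ∑ j, ys j * (Aᵀ *ᵥ u) j ^ 2)) := by
    intro k
    have h2 : (A *ᵥ (ys * (Aᵀ *ᵥ u))) k ^ 2 ≤ absSum A ^ 2 * ∑ j, ys j * (Aᵀ *ᵥ u) j ^ 2 :=
      sq_sum_mul_le hy.1 (A k) (Aᵀ *ᵥ u) (abs_le_absSum A k) hy.2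
    have h3 : linExponent A h ε v ys u w k ^ 2 ≤ 2 * (h * (1 - ε * v)) ^ 2 * (A *ᵥ w) k ^ 2
        + 2 * (h * ε) ^ 2 * (A *ᵥ (ys * (Aᵀ *ᵥ u))) k ^ 2 := by
      simp only [linExponent, Pi.sub_apply, Pi.smul_apply, smul_eq_mul]
      nlinarith [sq_nonneg (h * (1 - ε * v) * (A *ᵥ w) k + h * ε * (A *ᵥ (ys * (Aᵀ *ᵥ u))) k)]
    have h4 := mul_le_mul_of_nonneg_left h2 (by positivity : (0:ℝ) ≤ 2 * (h * ε) ^ 2)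
    have h5 := mul_le_mul_of_nonneg_left (h3.trans (add_le_add_right h4 _)) (hx.1 k)
    linarith
  refine (Finset.sum_le_sum fun k _ => h1 k).trans_eq ?_
  rw [Finset.sum_add_distrib, ← Finset.mul_sum, ← Finset.sum_mul, hx.2, one_mul]

/-- The Hessian term turns into minus a sum of squares: this is the dissipation that plain
multiplicative weights does not have. -/
theorem dotProduct_linExponent {n m : ℕ} (A : Matrix (Fin n) (Fin m) ℝ) (h ε v : ℝ)
    (ys : Fin m → ℝ) (u : Fin n → ℝ) (w : Fin m → ℝ) :
    u ⬝ᵥ linExponent A h ε v ys u w = h * (1 - ε * v) * (u ⬝ᵥ (A *ᵥ w))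
      - h * ε * ∑ j, ys j * (Aᵀ *ᵥ u) j ^ 2 := by
  rw [linExponent, dotProduct_sub, dotProduct_smul, dotProduct_smul,
    dotProduct_mulVec u A (ys * _), ← mulVec_transpose]
  simp only [smul_eq_mul, dotProduct, Pi.mul_apply]
  congr 2
  exact Finset.sum_congr rfl fun j _ => by ring

/-! ### Coercivity. -/

/-- Weak invertibility makes the degenerate quadratic form `w ↦ ∑ xs (A w)²` coercive, up to the
coordinates outside the support, on vectors summing to zero. -/
theorem WeaklyInvertible.exists_coercive {n m : ℕ} {A : Matrix (Fin n) (Fin m) ℝ}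
    {xs : Fin n → ℝ} {ys : Fin m → ℝ} (hxs : ∀ i, 0 ≤ xs i)
    (hA : WeaklyInvertible (sumZero (Supp ys) : Set (Supp ys → ℝ)) (restrict A xs ys)) :
    ∃ c : ℝ, 0 ≤ c ∧ ∀ w : Fin m → ℝ, ∑ j, w j = 0 → ∀ j, w j ^ 2 ≤
      c * (∑ i, xs i * (A *ᵥ w) i ^ 2 + ∑ j, if ys j = 0 then w j ^ 2 else 0) := by
  -- An injective linear map on a finite-dimensional space is antilipschitz, so it suffices that `T`
  -- has trivial kernel; the weights `√(xs i)` make squared entries match the quadratic form.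
  let T : sumZero (Fin m) →ₗ[ℝ] (Fin n → ℝ) × (Fin m → ℝ) :=
    { toFun := fun w => (fun i => √(xs i) * (A *ᵥ w.1) i, fun j => if ys j = 0 then w.1 j else 0)
      map_add' := fun a b => by
        ext j <;> simp [mulVec_add, mul_add]
        split_ifs <;> simp
      map_smul' := fun t a => by
        ext j <;> simp [mulVec_smul, mul_left_comm] }
  have hker : LinearMap.ker T = ⊥ := by
    rw [LinearMap.ker_eq_bot']
    rintro ⟨w, hw⟩ h0
    have h1 : ∀ i, √(xs i) * (A *ᵥ w) i = 0 := fun i => congrFun (congrArg Prod.fst h0) i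
    have h2 : ∀ j, ys j = 0 → w j = 0 := fun j hj => by
      have := congrFun (congrArg Prod.snd h0) j
      simpa [T, hj] using this
    have hsum : ∀ f : Fin m → ℝ, ∑ j : Supp ys, f j * w j = ∑ j, f j * w j := by
      intro f
      rw [← Finset.sum_subtype (Finset.univ.filter fun j => ys j ≠ 0) (by simp)
        fun j => f j * w j, Finset.sum_filter]
      refine Finset.sum_congr rfl fun j _ => ?_
      split_ifs with hj
      · rfl
      · simp [h2 j (not_not.1 hj)]
    by_contra hne
    refine hA (fun j => w j) ?_ ?_ ?_
    · change ∑ j : Supp ys, w j = 0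
      simpa [show ∑ j, w j = 0 from hw] using hsum 1
    · intro h3
      refine hne (Subtype.ext (funext fun j => ?_))
      by_cases hj : ys j = 0
      · exact h2 j hj
      · exact congrFun h3 ⟨j, hj⟩
    · funext i
      have h3 := h1 i
      have h4 : √(xs i) ≠ 0 :=
        (Real.sqrt_pos.2 (lt_of_le_of_ne (hxs i) (Ne.symm i.2))).ne'
      exact (hsum (A i)).trans ((mul_eq_zero.1 h3).resolve_left h4)
  obtain ⟨K, -, hK⟩ := T.exists_antilipschitzWith hker
  refine ⟨(K : ℝ) ^ 2, by positivity, fun w hw j => ?_⟩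
  have h1 : ‖(⟨w, hw⟩ : sumZero (Fin m))‖ ≤ K * ‖T ⟨w, hw⟩‖ := by
    simpa using hK.le_mul_norm (map_zero T) ⟨w, hw⟩
  have h2 : |w j| ≤ K * ‖T ⟨w, hw⟩‖ := (norm_le_pi_norm w j).trans h1
  have hX : ∀ i, 0 ≤ xs i * (A *ᵥ w) i ^ 2 := fun i => mul_nonneg (hxs i) (sq_nonneg _)
  have hW : ∀ j, 0 ≤ if ys j = 0 then w j ^ 2 else 0 := fun j => by split_ifs <;> positivity
  have hX' := Finset.sum_nonneg fun i (_ : i ∈ Finset.univ) => hX i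
  have hW' := Finset.sum_nonneg fun i (_ : i ∈ Finset.univ) => hW i
  have h3 : ‖T ⟨w, hw⟩‖ ≤
      √(∑ i, xs i * (A *ᵥ w) i ^ 2 + ∑ j, if ys j = 0 then w j ^ 2 else 0) := by
    refine norm_prod_le_iff.2 ⟨?_, ?_⟩ <;>
      refine (pi_norm_le_iff_of_nonneg (Real.sqrt_nonneg _)).2 fun i => Real.abs_le_sqrt ?_
    · have h4 := Finset.single_le_sum (fun i _ => hX i) (Finset.mem_univ i)
      change (√(xs i) * (A *ᵥ w) i) ^ 2 ≤ _
      rw [mul_pow, Real.sq_sqrt (hxs i)]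
      linarith
    · have h4 := Finset.single_le_sum (fun i _ => hW i) (Finset.mem_univ i)
      change (if ys i = 0 then w i else 0) ^ 2 ≤ _
      rw [ite_pow, zero_pow two_ne_zero]
      linarith
  have h4 := pow_le_pow_left₀ (abs_nonneg _) (h2.trans (mul_le_mul_of_nonneg_left h3 K.2)) 2
  rwa [sq_abs, mul_pow, Real.sq_sqrt (add_nonneg hX' hW')] at h4

/-! ### Off-support mass and the linearisation error. -/

/-- The mass that `x` puts outside the support of `z`. -/
noncomputable def offMass {ι : Type*} [Fintype ι] (z x : ι → ℝ) : ℝ :=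
  ∑ i, if z i = 0 then x i else 0

theorem offMass_nonneg {ι : Type*} [Fintype ι] {z x : ι → ℝ} (hx : ∀ i, 0 ≤ x i) :
    0 ≤ offMass z x :=
  Finset.sum_nonneg fun i _ => by split_ifs; exacts [hx i, le_rfl]

theorem le_offMass {ι : Type*} [Fintype ι] {z x : ι → ℝ} (hx : ∀ i, 0 ≤ x i) {i : ι}
    (hi : z i = 0) : x i ≤ offMass z x := by
  have := Finset.single_le_sum (f := fun i => if z i = 0 then x i else 0)
    (fun i _ => by split_ifs; exacts [hx i, le_rfl]) (Finset.mem_univ i)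
  simpa [offMass, hi] using this

theorem sum_sub_eq_zero {ι : Type*} [Fintype ι] {x z : ι → ℝ} (hx : x ∈ stdSimplex ℝ ι)
    (hz : z ∈ stdSimplex ℝ ι) : ∑ i, (x - z) i = 0 := by
  simp [hx.2, hz.2]

/-- Here `r` bounds the distance to equilibrium and `o` the off-support coordinates. The slacks `Aᵀ
xs - v` and `A ys - v` vanish on the supports, so terms paired with them are `O(o)`; what is left is
quadratic in `r`. -/
theorem RegularPair.exists_remainder_bound {n m : ℕ} {A : Matrix (Fin n) (Fin m) ℝ}
    {xs : Fin n → ℝ} {ys : Fin m → ℝ} {v : ℝ} (hR : RegularPair A xs ys v) (h ε : ℝ) :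
    ∃ K : ℝ, 0 ≤ K ∧ ∀ x ∈ stdSimplex ℝ (Fin n), ∀ y ∈ stdSimplex ℝ (Fin m), ∀ r o : ℝ, 0 ≤ r →
      (∀ i, |(x - xs) i| ≤ r) → (∀ j, |(y - ys) j| ≤ r) →
      (∀ i, xs i = 0 → |(x - xs) i| ≤ o) → (∀ j, ys j = 0 → |(y - ys) j| ≤ o) → 0 ≤ o → ∀ k,
      |exponent A h ε x y k - xs ⬝ᵥ exponent A h ε x y - h * (1 - ε * v) * ((A *ᵥ ys) k - v)
        - linExponent A h ε v ys (x - xs) (y - ys) k| ≤ K * (o + r ^ 2) := by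
  set S := absSum A with hS
  set β : Fin m → ℝ := (Aᵀ *ᵥ xs) - fun _ => v with hβ
  set α : Fin n → ℝ := (A *ᵥ ys) - fun _ => v with hα
  set B := ∑ j, |β j| with hB
  set B' := ∑ j, |α j| with hB'
  have hS0 : 0 ≤ S := absSum_nonneg A
  have hB0 : 0 ≤ B := Finset.sum_nonneg fun _ _ => abs_nonneg _
  have hB0' : 0 ≤ B' := Finset.sum_nonneg fun _ _ => abs_nonneg _
  have hβ0 : ∀ j, β j ≠ 0 → ys j = 0 := fun j hj => by
    by_contra h0
    exact hj (sub_eq_zero.2 (hR.col_eq j h0))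
  have hα0 : ∀ j, α j ≠ 0 → xs j = 0 := fun j hj => by
    by_contra h0
    exact hj (sub_eq_zero.2 (hR.row_eq j h0))
  -- The three summands bound the nonlinear term `e` at `k`, the mean of `linExponent`, and the mean
  -- of `e`.
  refine ⟨|h * ε| * (S * (B + S)) + (|h * (1 - ε * v)| * B + |h * ε| * (|v| * B'))
    + |h * ε| * (S * (B + S)), by positivity, ?_⟩
  intro x hx y hy r o hr hu hw huo hwo ho k
  set u := x - xs with hu_def
  set w := y - ys with hw_def
  set e := A *ᵥ (w * (β + Aᵀ *ᵥ u)) with he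
  have hE : o ≤ o + r ^ 2 := by nlinarith
  have he_bound : ∀ k, |e k| ≤ S * (B + S) * (o + r ^ 2) := by
    intro k
    rw [mul_assoc]
    refine abs_mulVec_le A (by positivity) (fun j => ?_) k
    have h1 : |(Aᵀ *ᵥ u) j| ≤ S * r := by
      simpa [absSum_transpose] using abs_mulVec_le Aᵀ hr hu j
    have h2 : |w j * β j| ≤ B * o := by
      rw [abs_mul]
      rcases eq_or_ne (β j) 0 with h0 | h0
      · simp only [h0, abs_zero, mul_zero]
        positivity
      · rw [mul_comm]
        exact mul_le_mul (Finset.single_le_sum (f := fun j => |β j|) (fun _ _ => abs_nonneg _)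
          (Finset.mem_univ j)) (hwo j (hβ0 j h0)) (abs_nonneg _) hB0
    have h3 : |w j * (Aᵀ *ᵥ u) j| ≤ r * (S * r) := by
      rw [abs_mul]
      exact mul_le_mul (hw j) h1 (abs_nonneg _) hr
    have h4 : (w * (β + Aᵀ *ᵥ u)) j = w j * β j + w j * (Aᵀ *ᵥ u) j := by
      simp [mul_add]
    rw [h4]
    refine (abs_add_le _ _).trans ((add_le_add h2 h3).trans ?_)
    nlinarith [mul_nonneg hB0 (sq_nonneg r), mul_nonneg hS0 ho]
  have he_mean : |xs ⬝ᵥ e| ≤ S * (B + S) * (o + r ^ 2) := by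
    have h1 := abs_dotProduct_le xs e (fun j _ => he_bound j)
    have h2 : ∑ j, |xs j| = 1 := by
      rw [← hR.left_mem.2]
      exact Finset.sum_congr rfl fun i _ => abs_of_nonneg (hR.left_mem.1 i)
    rwa [h2, one_mul] at h1
  -- As `u` and `w` sum to zero, subtracting the constant `v` is free and only the slacks survive.
  have hmean : xs ⬝ᵥ linExponent A h ε v ys u w =
      h * (1 - ε * v) * (β ⬝ᵥ w) - h * ε * (v * (α ⬝ᵥ u)) := by
    have h1 : (fun _ => v) ⬝ᵥ w = 0 := by
      simp only [dotProduct, ← Finset.mul_sum]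
      rw [sum_sub_eq_zero hy hR.right_mem, mul_zero]
    have h2 : (fun _ => v) ⬝ᵥ u = 0 := by
      simp only [dotProduct, ← Finset.mul_sum]
      rw [sum_sub_eq_zero hx hR.left_mem, mul_zero]
    have h3 : (Aᵀ *ᵥ xs) ⬝ᵥ (ys * (Aᵀ *ᵥ u)) = v * ((A *ᵥ ys) ⬝ᵥ u) := by
      rw [dotProduct_comm (A *ᵥ ys), dotProduct_mulVec u A ys, ← mulVec_transpose]
      simp only [dotProduct, Pi.mul_apply, Finset.mul_sum]
      refine Finset.sum_congr rfl fun j _ => ?_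
      rcases eq_or_ne (ys j) 0 with h0 | h0
      · simp [h0]
      · rw [hR.col_eq j h0]
        ring
    rw [linExponent, dotProduct_sub, dotProduct_smul, dotProduct_smul, dotProduct_mulVec xs A,
      dotProduct_mulVec xs A, ← mulVec_transpose, h3, hβ, hα, sub_dotProduct, sub_dotProduct,
      h1, h2]
    simp
  have hlin_mean : |xs ⬝ᵥ linExponent A h ε v ys u w| ≤
      (|h * (1 - ε * v)| * B + |h * ε| * (|v| * B')) * (o + r ^ 2) := by
    rw [hmean]
    refine (abs_sub _ _).trans ?_
    rw [abs_mul (h * (1 - ε * v)), abs_mul (h * ε), abs_mul v]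
    have h1 : |β ⬝ᵥ w| ≤ B * (o + r ^ 2) :=
      (abs_dotProduct_le β w fun j hj => hwo j (hβ0 j hj)).trans
        (mul_le_mul_of_nonneg_left hE hB0)
    have h2 : |α ⬝ᵥ u| ≤ B' * (o + r ^ 2) :=
      (abs_dotProduct_le α u fun j hj => huo j (hα0 j hj)).trans
        (mul_le_mul_of_nonneg_left hE hB0')
    have h3 := mul_le_mul_of_nonneg_left h1 (abs_nonneg (h * (1 - ε * v)))
    have h4 := mul_le_mul_of_nonneg_left (mul_le_mul_of_nonneg_left h2 (abs_nonneg v))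
      (abs_nonneg (h * ε))
    linarith
  have hmean_exp : xs ⬝ᵥ exponent A h ε x y = h * (1 - ε * v) * v
      + xs ⬝ᵥ linExponent A h ε v ys u w - h * ε * (xs ⬝ᵥ e) := by
    have h1 : xs ⬝ᵥ (A *ᵥ ys) = v := by
      have h2 : ∀ i, xs i * (A *ᵥ ys) i = xs i * v := fun i => by
        rcases eq_or_ne (xs i) 0 with h0 | h0
        · simp [h0]
        · rw [hR.row_eq i h0]
      simp only [dotProduct, h2, ← Finset.sum_mul, hR.left_mem.2, one_mul]
    rw [hR.exponent_eq, dotProduct_sub, dotProduct_add, dotProduct_smul, dotProduct_smul, h1]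
    simp only [smul_eq_mul]
    rfl
  have hfinal : exponent A h ε x y k - xs ⬝ᵥ exponent A h ε x y
      - h * (1 - ε * v) * ((A *ᵥ ys) k - v) - linExponent A h ε v ys u w k
      = -(h * ε * e k) - xs ⬝ᵥ linExponent A h ε v ys u w + h * ε * (xs ⬝ᵥ e) := by
    rw [hmean_exp, hR.exponent_eq]
    simp only [Pi.sub_apply, Pi.add_apply, Pi.smul_apply, smul_eq_mul]
    ring
  rw [hfinal]
  refine (abs_add_le _ _).trans ((add_le_add_left (abs_sub _ _) _).trans ?_)
  rw [abs_neg, abs_mul (h * ε), abs_mul (h * ε)]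
  have h1 := mul_le_mul_of_nonneg_left (he_bound k) (abs_nonneg (h * ε))
  have h2 := mul_le_mul_of_nonneg_left he_mean (abs_nonneg (h * ε))
  linarith

/-! ### Entropy change of one player. -/

theorem continuous_exponent {n m : ℕ} (A : Matrix (Fin n) (Fin m) ℝ) (h ε : ℝ) :
    Continuous fun p : (Fin n → ℝ) × (Fin m → ℝ) => exponent A h ε p.1 p.2 := by
  unfold exponent
  fun_prop

/-- On the support the centred exponent `G` tends to zero and `exp G - 1 ≤ G + G²`; off the support
regularity gives `exp G - 1 < -η`. The linear part of `G` supplies the bilinear and dissipative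
terms. -/
theorem RegularPair.exists_log_sum_exp_bound {n m : ℕ} {A : Matrix (Fin n) (Fin m) ℝ}
    {xs : Fin n → ℝ} {ys : Fin m → ℝ} {v : ℝ} (hR : RegularPair A xs ys v) {h ε : ℝ}
    (hh : 0 < h) (hεv : ε * v < 1) :
    ∃ K η : ℝ, 0 ≤ K ∧ 0 < η ∧ ∀ᶠ p in 𝓝 (xs, ys),
      p.1 ∈ stdSimplex ℝ (Fin n) → p.2 ∈ stdSimplex ℝ (Fin m) → ∀ r o : ℝ, 0 ≤ r → r ≤ 1 →
      (∀ i, |(p.1 - xs) i| ≤ r) → (∀ j, |(p.2 - ys) j| ≤ r) →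
      offMass xs p.1 + offMass ys p.2 ≤ o → o ≤ (n + m) * r →
      Real.log (∑ k, p.1 k * Real.exp (exponent A h ε p.1 p.2 k))
          - xs ⬝ᵥ exponent A h ε p.1 p.2 ≤
        h * (1 - ε * v) * ((p.1 - xs) ⬝ᵥ (A *ᵥ (p.2 - ys)))
        - h * ε * ∑ j, ys j * (Aᵀ *ᵥ (p.1 - xs)) j ^ 2
        + 4 * ∑ k, xs k * linExponent A h ε v ys (p.1 - xs) (p.2 - ys) k ^ 2
        - η * offMass xs p.1 + K * (r * (o + r ^ 2)) := by
  obtain ⟨K₁, hK₁, hrem⟩ := hR.exists_remainder_bound h ε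
  set a := h * (1 - ε * v) with ha_def
  have ha : 0 < a := mul_pos hh (by linarith)
  obtain ⟨η, hη, hηk⟩ : ∃ η : ℝ, 0 < η ∧
      ∀ k, xs k = 0 → Real.exp (a * ((A *ᵥ ys) k - v)) - 1 < -η := by
    have h1 : ∀ᶠ η in 𝓝[>] (0 : ℝ),
        ∀ k, xs k = 0 → Real.exp (a * ((A *ᵥ ys) k - v)) - 1 < -η := by
      refine eventually_all.2 fun k => ?_
      by_cases hk : xs k = 0
      · have h2 : Real.exp (a * ((A *ᵥ ys) k - v)) < 1 :=
          Real.exp_lt_one_iff.2 (mul_neg_of_pos_of_neg ha (by linarith [hR.row_lt k hk]))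
        filter_upwards [nhdsWithin_le_nhds (gt_mem_nhds (sub_pos.2 h2))] with η h3 _
        linarith [show η < 1 - _ from h3]
      · simp [hk]
    obtain ⟨η, h2, h3⟩ := (h1.and self_mem_nhdsWithin).exists
    exact ⟨η, h3, h2⟩
  set G : (Fin n → ℝ) × (Fin m → ℝ) → Fin n → ℝ :=
    fun p k => exponent A h ε p.1 p.2 k - xs ⬝ᵥ exponent A h ε p.1 p.2 with hG
  have hG_cont : ∀ k, Continuous fun p => G p k := fun k =>
    ((continuous_apply k).comp (continuous_exponent A h ε)).sub
      (continuous_const.dotProduct (continuous_exponent A h ε))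
  have hG_val : ∀ k, G (xs, ys) k = a * ((A *ᵥ ys) k - v) := by
    -- The remainder bound with `r = o = 0` is an equality at the equilibrium.
    intro k
    have h1 := hrem xs hR.left_mem ys hR.right_mem 0 0 le_rfl (by simp) (by simp) (by simp)
      (by simp) le_rfl k
    simp only [zero_pow two_ne_zero, add_zero, mul_zero, abs_nonpos_iff] at h1
    simp only [linExponent, sub_self, mulVec_zero, mul_zero, smul_zero, Pi.zero_apply,
      sub_zero] at h1
    exact sub_eq_zero.1 h1
  have hon : ∀ᶠ p in 𝓝 (xs, ys), ∀ k, xs k ≠ 0 → |G p k| < 1 ∧ p.1 k < 2 * xs k := by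
    refine eventually_all.2 fun k => ?_
    by_cases hk : xs k = 0
    · simp [hk]
    have hpos : 0 < xs k := lt_of_le_of_ne (hR.left_mem.1 k) (Ne.symm hk)
    have h1 : |G (xs, ys) k| < 1 := by simp [hG_val, hR.row_eq k hk]
    have h2 : Continuous fun p : (Fin n → ℝ) × (Fin m → ℝ) => p.1 k := by fun_prop
    filter_upwards [(hG_cont k).abs.continuousAt.eventually (gt_mem_nhds h1),
      h2.continuousAt.eventually (gt_mem_nhds (show (xs, ys).1 k < 2 * xs k by simp [hpos]))]
      with p h3 h4 _ using ⟨h3, h4⟩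
  have hoff : ∀ᶠ p in 𝓝 (xs, ys), ∀ k, xs k = 0 → Real.exp (G p k) - 1 < -η := by
    refine eventually_all.2 fun k => ?_
    by_cases hk : xs k = 0
    · have h1 : Real.exp (G (xs, ys) k) - 1 < -η := by rw [hG_val]; exact hηk k hk
      filter_upwards [((hG_cont k).rexp.sub continuous_const).continuousAt.eventually (gt_mem_nhds h1)]
        with p h2 _ using h2
    · simp [hk]
  set K₂ := |a| * absSum A + |h * ε| * (absSum A * absSum A) with hK₂
  have hK₂0 : 0 ≤ K₂ := by have := absSum_nonneg A; positivity
  -- Per coordinate, `K₁` pays for `u k * R`, `K₂` for adding `u k * l k` off the support, and the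
  -- last summand for `4 * R ^ 2`; there are `n` coordinates.
  refine ⟨n * (K₁ + K₂ + 4 * K₁ ^ 2 * (n + m + 1)), η, by positivity, hη, ?_⟩
  filter_upwards [hon, hoff] with p hon hoff hx hy r o hr hr1 hu hw hoo hor
  obtain ⟨x, y⟩ := p
  simp only at *
  have hox := offMass_nonneg (z := xs) hx.1
  have hoy := offMass_nonneg (z := ys) hy.1
  have ho : 0 ≤ o := by linarith
  have hrem' := hrem x hx y hy r o hr hu hw
    (fun i hi => by
      rw [Pi.sub_apply, hi, sub_zero, abs_of_nonneg (hx.1 i)]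
      linarith [le_offMass hx.1 hi])
    (fun j hj => by
      rw [Pi.sub_apply, hj, sub_zero, abs_of_nonneg (hy.1 j)]
      linarith [le_offMass hy.1 hj]) ho
  set u := x - xs with hu_def
  set w := y - ys with hw_def
  set l := linExponent A h ε v ys u w with hl
  have hl_bound : ∀ k, |l k| ≤ K₂ * r := by
    intro k
    have h1 := abs_mulVec_le A hr hw k
    have h2 : |(A *ᵥ (ys * (Aᵀ *ᵥ u))) k| ≤ absSum A * (absSum A * r) := by
      refine abs_mulVec_le A (mul_nonneg (absSum_nonneg A) hr) (fun j => ?_) k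
      have h3 : |(Aᵀ *ᵥ u) j| ≤ absSum A * r := by
        simpa [absSum_transpose] using abs_mulVec_le Aᵀ hr hu j
      have h4 : ys j ≤ 1 := by
        rw [← hR.right_mem.2]
        exact Finset.single_le_sum (fun j _ => hR.right_mem.1 j) (Finset.mem_univ j)
      rw [Pi.mul_apply, abs_mul, abs_of_nonneg (hR.right_mem.1 j)]
      exact (mul_le_of_le_one_left (abs_nonneg _) h4).trans h3
    have h5 : l k = a * (A *ᵥ w) k - h * ε * (A *ᵥ (ys * (Aᵀ *ᵥ u))) k := rfl
    rw [h5]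
    refine (abs_sub _ _).trans ?_
    rw [abs_mul a, abs_mul (h * ε)]
    have h6 := mul_le_mul_of_nonneg_left h1 (abs_nonneg a)
    have h7 := mul_le_mul_of_nonneg_left h2 (abs_nonneg (h * ε))
    linarith
  have hE : 0 ≤ o + r ^ 2 := by positivity
  have hEr : o + r ^ 2 ≤ (n + m + 1) * r := by nlinarith
  have hterm : ∀ k, x k * (Real.exp (G (x, y) k) - 1) ≤
      xs k * G (x, y) k + u k * l k + 4 * (xs k * l k ^ 2)
        - η * (if xs k = 0 then x k else 0)
        + (K₁ + K₂ + 4 * K₁ ^ 2 * (n + m + 1)) * (r * (o + r ^ 2)) := by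
    intro k
    have hrE : 0 ≤ r * (o + r ^ 2) := mul_nonneg hr hE
    have hc : 0 ≤ 4 * K₁ ^ 2 * (n + m + 1) * (r * (o + r ^ 2)) := by positivity
    by_cases hk : xs k = 0
    · have h1 := mul_le_mul_of_nonneg_left (hoff k hk).le (hx.1 k)
      have huk : u k = x k := by simp [hu_def, hk]
      have h2 : -(u k * l k) ≤ o * (K₂ * r) := by
        refine (neg_le_abs _).trans ?_
        rw [abs_mul, huk, abs_of_nonneg (hx.1 k)]
        exact mul_le_mul (by linarith [le_offMass hx.1 hk]) (hl_bound k) (abs_nonneg _) ho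
      have h3 : o * (K₂ * r) ≤ K₂ * (r * (o + r ^ 2)) := by
        have : 0 ≤ K₂ * (r * r ^ 2) := by positivity
        linarith
      have h4 : 0 ≤ K₁ * (r * (o + r ^ 2)) := mul_nonneg hK₁ hrE
      simp only [hk, if_true, zero_mul]
      linarith
    · obtain ⟨h1, h2⟩ := hon k hk
      have h3 : Real.exp (G (x, y) k) - 1 ≤ G (x, y) k + G (x, y) k ^ 2 := by
        have := (abs_le.1 (Real.abs_exp_sub_one_sub_id_le h1.le)).2
        linarith
      have h4 : |G (x, y) k - l k| ≤ K₁ * (o + r ^ 2) := by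
        simpa [hR.row_eq k hk] using hrem' k
      set R := G (x, y) k - l k with hRdef
      have hGR : G (x, y) k = l k + R := by ring
      have h5 := mul_le_mul_of_nonneg_left h3 (hx.1 k)
      -- The coefficient 4 is 2 from `x k < 2 * xs k` times 2 from `(l + R)² ≤ 2 l² + 2 R²`.
      have h6 : x k * G (x, y) k ^ 2 ≤ 2 * xs k * G (x, y) k ^ 2 :=
        mul_le_mul_of_nonneg_right h2.le (sq_nonneg _)
      have hxs0 := hR.left_mem.1 k
      have hxs1 : xs k ≤ 1 := by
        rw [← hR.left_mem.2]
        exact Finset.single_le_sum (fun j _ => hR.left_mem.1 j) (Finset.mem_univ k)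
      have h7 : xs k * G (x, y) k ^ 2 ≤ 2 * (xs k * l k ^ 2) + 2 * R ^ 2 := by
        have h8 : G (x, y) k ^ 2 ≤ 2 * l k ^ 2 + 2 * R ^ 2 := by
          rw [hGR]
          nlinarith [sq_nonneg (l k - R)]
        have h9 := mul_le_mul_of_nonneg_left h8 hxs0
        have h10 := mul_le_of_le_one_left (sq_nonneg R) hxs1
        linarith
      have h8 : R ^ 2 ≤ K₁ ^ 2 * (n + m + 1) * (r * (o + r ^ 2)) := by
        have h9 := pow_le_pow_left₀ (abs_nonneg _) h4 2
        rw [sq_abs] at h9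
        have h10 := mul_le_mul_of_nonneg_left (mul_le_mul_of_nonneg_right hEr hE) (sq_nonneg K₁)
        linarith
      have h9 : u k * R ≤ K₁ * (r * (o + r ^ 2)) := by
        refine (le_abs_self _).trans ?_
        rw [abs_mul]
        refine (mul_le_mul (hu k) h4 (abs_nonneg _) hr).trans_eq (by ring)
      have h10 : x k * G (x, y) k = xs k * G (x, y) k + u k * l k + u k * R := by
        have : x k = xs k + u k := by simp [hu_def]
        rw [this, hGR]
        ring
      have h11 : 0 ≤ K₂ * (r * (o + r ^ 2)) := mul_nonneg hK₂0 hrE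
      simp only [hk, if_false, mul_zero]
      linarith
  have hsumG : ∑ k, xs k * G (x, y) k = 0 := by
    simp only [hG, mul_sub, Finset.sum_sub_distrib, ← Finset.sum_mul, hR.left_mem.2, one_mul]
    exact sub_self _
  refine (log_sum_mul_exp_sub_le hx _ _).trans ((Finset.sum_le_sum fun k _ => hterm k).trans ?_)
  rw [Finset.sum_add_distrib, Finset.sum_sub_distrib, Finset.sum_add_distrib,
    Finset.sum_add_distrib, hsumG, ← Finset.mul_sum, ← Finset.mul_sum, Finset.sum_const,
    Finset.card_univ, Fintype.card_fin, nsmul_eq_mul,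
    show ∑ k, u k * l k = _ from dotProduct_linExponent A h ε v ys u w]
  simp only [offMass]
  linarith

/-! ### Decrease of the weighted entropy. -/

theorem offMass_le {ι : Type*} [Fintype ι] {z x : ι → ℝ} {r : ℝ} (hr : 0 ≤ r)
    (h : ∀ i, |(x - z) i| ≤ r) : offMass z x ≤ Fintype.card ι * r := by
  have h1 : ∀ i, (if z i = 0 then x i else 0) ≤ r := fun i => by
    split_ifs with hi
    · simpa [hi] using (le_abs_self _).trans (h i)
    · exact hr
  simpa [offMass] using Finset.sum_le_sum fun i (_ : i ∈ Finset.univ) => h1 i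

theorem sum_off_sq_le_offMass {ι : Type*} [Fintype ι] {z x : ι → ℝ}
    (hx : x ∈ stdSimplex ℝ ι) :
    (∑ i, if z i = 0 then (x - z) i ^ 2 else 0) ≤ offMass z x := by
  refine Finset.sum_le_sum fun i _ => ?_
  split_ifs with hi
  · have h1 : x i ≤ 1 := by
      rw [← hx.2]
      exact Finset.single_le_sum (fun j _ => hx.1 j) (Finset.mem_univ i)
    rw [Pi.sub_apply, hi, sub_zero]
    nlinarith [hx.1 i]
  · exact le_rfl

/-- The weighted sum of the two relative entropies with respect to an equilibrium of value `v`. -/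
noncomputable def lyapunov {n m : ℕ} (ε v : ℝ) (xs : Fin n → ℝ) (ys : Fin m → ℝ)
    (p : (Fin n → ℝ) × (Fin m → ℝ)) : ℝ :=
  (1 + ε * v) * relEnt xs p.1 + (1 - ε * v) * relEnt ys p.2

/-- The points of the product of simplices that charge the supports of `xs` and `ys`. -/
def supportedPairs {n m : ℕ} (xs : Fin n → ℝ) (ys : Fin m → ℝ) :
    Set ((Fin n → ℝ) × (Fin m → ℝ)) :=
  {p | (p.1 ∈ stdSimplex ℝ (Fin n) ∧ p.2 ∈ stdSimplex ℝ (Fin m)) ∧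
    (∀ i, xs i ≠ 0 → 0 < p.1 i) ∧ ∀ j, ys j ≠ 0 → 0 < p.2 j}

theorem mapsTo_step {n m : ℕ} (A : Matrix (Fin n) (Fin m) ℝ) (h ε : ℝ) (xs : Fin n → ℝ)
    (ys : Fin m → ℝ) : Set.MapsTo (step A h ε) (supportedPairs xs ys) (supportedPairs xs ys) := by
  rintro p ⟨⟨h1, h2⟩, h3, h4⟩
  simp only [step, phi₁_eq, phi₂_eq]
  exact ⟨⟨expWeight_mem h1 _, expWeight_mem h2 _⟩, fun i hi => expWeight_pos h1 _ (h3 i hi),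
    fun j hj => expWeight_pos h2 _ (h4 j hj)⟩

theorem lyapunov_step {n m : ℕ} (A : Matrix (Fin n) (Fin m) ℝ) (h ε v : ℝ) {xs : Fin n → ℝ}
    {ys : Fin m → ℝ} (hx : xs ∈ stdSimplex ℝ (Fin n)) (hy : ys ∈ stdSimplex ℝ (Fin m))
    {p : (Fin n → ℝ) × (Fin m → ℝ)} (hp : p ∈ supportedPairs xs ys) :
    lyapunov ε v xs ys (step A h ε p) = lyapunov ε v xs ys p
      + ((1 + ε * v) * (Real.log (∑ k, p.1 k * Real.exp (exponent A h ε p.1 p.2 k))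
          - xs ⬝ᵥ exponent A h ε p.1 p.2)
        + (1 - ε * v) * (Real.log (∑ k, p.2 k * Real.exp (exponent (-Aᵀ) h ε p.2 p.1 k))
          - ys ⬝ᵥ exponent (-Aᵀ) h ε p.2 p.1)) := by
  simp only [lyapunov, step, phi₁_eq, phi₂_eq]
  rw [relEnt_expWeight hx hp.1.1 hp.2.1, relEnt_expWeight hy hp.1.2 hp.2.2]
  ring

/-- The second-order terms of the change of the Lyapunov function are negative for small `h`. -/
theorem quadratic_terms_le {a b h ε S X Y L M : ℝ} (ha : 0 < a) (hb : 0 < b) (hab : a * b ≤ 1)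
    (hh : 0 < h) (hε : 0 < ε) (hX : 0 ≤ X) (hY : 0 ≤ Y) (h1 : h * ε * S ^ 2 ≤ 1 / 32)
    (h2 : h ≤ ε / 32) (hL : L ≤ 2 * (h * a) ^ 2 * X + 2 * (h * ε) ^ 2 * (S ^ 2 * Y))
    (hM : M ≤ 2 * (h * b) ^ 2 * Y + 2 * (h * ε) ^ 2 * (S ^ 2 * X)) :
    b * (-(h * ε * Y) + 4 * L) + a * (-(h * ε * X) + 4 * M) ≤
      -(h * ε / 2 * (b * Y + a * X)) := by
  have e1 := mul_le_mul_of_nonneg_left hL hb.le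
  have e2 := mul_le_mul_of_nonneg_left hM ha.le
  -- With `1 / 32`, each of the two error types costs `8 / 32 = 1 / 4` of the dissipation, leaving
  -- half of it.
  have e3 : h * (a * b) ≤ ε / 32 := (mul_le_of_le_one_right hh.le hab).trans h2
  have e4 := mul_le_mul_of_nonneg_left e3 (by positivity : 0 ≤ h * a * X)
  have e5 := mul_le_mul_of_nonneg_left e3 (by positivity : 0 ≤ h * b * Y)
  have e6 := mul_le_mul_of_nonneg_left h1 (by positivity : 0 ≤ h * ε * b * Y)
  have e7 := mul_le_mul_of_nonneg_left h1 (by positivity : 0 ≤ h * ε * a * X)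
  have e8 : 0 ≤ h * ε * (b * Y) := by positivity
  have e9 : 0 ≤ h * ε * (a * X) := by positivity
  nlinarith

theorem RegularPair.exists_lyapunov_decrease {n m : ℕ} {A : Matrix (Fin n) (Fin m) ℝ}
    {xs : Fin n → ℝ} {ys : Fin m → ℝ} {v : ℝ} (hR : RegularPair A xs ys v)
    (hA : WeaklyInvertible (sumZero (Supp ys) : Set (Supp ys → ℝ)) (restrict A xs ys))
    (hAT : WeaklyInvertible (sumZero (Supp xs) : Set (Supp xs → ℝ)) (restrict A xs ys)ᵀ)
    {h ε : ℝ} (hh : 0 < h) (hε : 0 < ε) (hεv : |ε * v| < 1)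
    (h1 : h * ε * absSum A ^ 2 ≤ 1 / 32) (h2 : h ≤ ε / 32) :
    ∃ μ : ℝ, 0 < μ ∧ ∀ᶠ p in 𝓝 (xs, ys), p ∈ supportedPairs xs ys →
      lyapunov ε v xs ys (step A h ε p) ≤ lyapunov ε v xs ys p - μ * dist p (xs, ys) ^ 2 := by
  obtain ⟨hv1, hv2⟩ := abs_lt.1 hεv
  obtain ⟨K₁, η₁, hK₁, hη₁, hx⟩ := hR.exists_log_sum_exp_bound hh hv2
  obtain ⟨K₂, η₂, hK₂, hη₂, hy⟩ := hR.symm.exists_log_sum_exp_bound hh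
    (show ε * -v < 1 by linarith)
  obtain ⟨c₁, hc₁, hcoer₁⟩ := hA.exists_coercive hR.left_mem.1
  obtain ⟨c₂, hc₂, hcoer₂⟩ := WeaklyInvertible.exists_coercive (A := Aᵀ) (xs := ys) (ys := xs)
    hR.right_mem.1 hAT
  set a := 1 - ε * v with ha_def
  set b := 1 + ε * v with hb_def
  have ha : 0 < a := by linarith
  have hb : 0 < b := by linarith
  have hab : a * b ≤ 1 := by rw [ha_def, hb_def]; nlinarith [sq_nonneg (ε * v)]
  set K := b * K₁ + a * K₂ with hK
  have hK0 : 0 ≤ K := by positivity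
  -- Dissipation yields `κ (X + Y)` and regularity `2 κ` times the off-support mass; one `κ` of the
  -- latter absorbs `K r` times the mass. Coercivity turns the rest into `(κ / c) r²`, half of which
  -- absorbs `K r³`.
  obtain ⟨κ, hκ, hκ1, hκ2, hκ3, hκ4⟩ : ∃ κ : ℝ, 0 < κ ∧ κ ≤ h * ε / 2 * a ∧ κ ≤ h * ε / 2 * b ∧
      2 * κ ≤ b * η₁ ∧ 2 * κ ≤ a * η₂ := by
    refine ⟨min (min (h * ε / 2 * a) (h * ε / 2 * b)) (min (b * η₁ / 2) (a * η₂ / 2)),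
      by positivity, (min_le_left _ _).trans (min_le_left _ _),
      (min_le_left _ _).trans (min_le_right _ _), ?_, ?_⟩
    · linarith [(min_le_right (min (h * ε / 2 * a) (h * ε / 2 * b)) _).trans
        (min_le_left (b * η₁ / 2) (a * η₂ / 2))]
    · linarith [(min_le_right (min (h * ε / 2 * a) (h * ε / 2 * b)) _).trans
        (min_le_right (b * η₁ / 2) (a * η₂ / 2))]
  set c := c₁ + c₂ + 1 with hc
  have hc0 : 0 < c := by positivity
  have hdist : ∀ s : ℝ, 0 < s → ∀ᶠ p in 𝓝 (xs, ys), dist p (xs, ys) < s := fun s hs =>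
    Metric.ball_mem_nhds _ hs
  have hswap : Tendsto Prod.swap (𝓝 (xs, ys)) (𝓝 (ys, xs)) := continuous_swap.tendsto (xs, ys)
  refine ⟨κ / (2 * c), by positivity, ?_⟩
  filter_upwards [hx, hswap.eventually hy, hdist 1 one_pos,
    hdist (κ / (K + 1)) (by positivity), hdist (κ / (2 * c) / (K + 1)) (by positivity)]
    with p hx hy hr1 hr2 hr3 hp
  rw [lyapunov_step A h ε v hR.left_mem hR.right_mem hp]
  obtain ⟨x, y⟩ := p
  simp only [Prod.swap_prod_mk] at *
  set r := dist (x, y) (xs, ys) with hr_def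
  have hr : 0 ≤ r := dist_nonneg
  have hxm : x ∈ stdSimplex ℝ (Fin n) := hp.1.1
  have hym : y ∈ stdSimplex ℝ (Fin m) := hp.1.2
  have hu : ∀ i, |(x - xs) i| ≤ r := fun i =>
    (dist_le_pi_dist x xs i).trans (le_max_left _ _)
  have hw : ∀ j, |(y - ys) j| ≤ r := fun j =>
    (dist_le_pi_dist y ys j).trans (le_max_right _ _)
  have hox := offMass_nonneg (z := xs) hxm.1
  have hoy := offMass_nonneg (z := ys) hym.1
  have hox' : offMass xs x ≤ n * r := by simpa using offMass_le hr hu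
  have hoy' : offMass ys y ≤ m * r := by simpa using offMass_le hr hw
  have hsx := sum_off_sq_le_offMass (z := xs) hxm
  have hsy := sum_off_sq_le_offMass (z := ys) hym
  have hcx := hcoer₂ (x - xs) (sum_sub_eq_zero hxm hR.left_mem)
  have hcy := hcoer₁ (y - ys) (sum_sub_eq_zero hym hR.right_mem)
  have hx' := hx hxm hym r (offMass xs x + offMass ys y) hr hr1.le hu hw le_rfl (by linarith)
  have hy' := hy hym hxm r (offMass xs x + offMass ys y) hr hr1.le hw hu (by linarith)
    (by linarith)
  have hL := sum_linExponent_sq_le A h ε v hR.left_mem hR.right_mem (x - xs) (y - ys)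
  have hM := sum_linExponent_sq_le (-Aᵀ) h ε (-v) hR.right_mem hR.left_mem (y - ys) (x - xs)
  -- The bilinear terms are opposite and, multiplied by the weights `b` and `a`, both carry the
  -- coefficient `h * a * b`, so they cancel.
  have hcross : (y - ys) ⬝ᵥ (-Aᵀ *ᵥ (x - xs)) = -((x - xs) ⬝ᵥ (A *ᵥ (y - ys))) := by
    rw [neg_mulVec, dotProduct_neg, dotProduct_mulVec (x - xs), ← mulVec_transpose,
      dotProduct_comm]
  have hav : 1 - ε * -v = b := by rw [hb_def]; ring
  rw [hcross, hav] at hy'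
  rw [hav] at hM
  simp only [transpose_neg, transpose_transpose, neg_mulVec, Pi.neg_apply, neg_sq, absSum_neg,
    absSum_transpose] at hy' hM
  set X := ∑ k, xs k * (A *ᵥ (y - ys)) k ^ 2
  set Y := ∑ j, ys j * (Aᵀ *ᵥ (x - xs)) j ^ 2
  set L := ∑ k, xs k * linExponent A h ε v ys (x - xs) (y - ys) k ^ 2
  set M := ∑ k, ys k * linExponent (-Aᵀ) h ε (-v) xs (y - ys) (x - xs) k ^ 2
  set ox := offMass xs x
  set oy := offMass ys y
  have hX : 0 ≤ X := Finset.sum_nonneg fun i _ => mul_nonneg (hR.left_mem.1 i) (sq_nonneg _)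
  have hY : 0 ≤ Y := Finset.sum_nonneg fun i _ => mul_nonneg (hR.right_mem.1 i) (sq_nonneg _)
  have hquad := quadratic_terms_le ha hb hab hh hε hX hY h1 h2 hL hM
  have hbound : r ^ 2 ≤ c * (X + Y + (ox + oy)) := by
    have h3 : r ≤ √(c * (X + Y + (ox + oy))) := by
      refine max_le ((dist_pi_le_iff (Real.sqrt_nonneg _)).2 fun i => Real.abs_le_sqrt ?_)
        ((dist_pi_le_iff (Real.sqrt_nonneg _)).2 fun i => Real.abs_le_sqrt ?_)
      · refine (hcx i).trans (mul_le_mul (by linarith) (by linarith) ?_ hc0.le)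
        exact add_nonneg hY (Finset.sum_nonneg fun i _ => by split_ifs <;> positivity)
      · refine (hcy i).trans (mul_le_mul (by linarith) (by linarith) ?_ hc0.le)
        exact add_nonneg hX (Finset.sum_nonneg fun i _ => by split_ifs <;> positivity)
    have h4 := pow_le_pow_left₀ hr h3 2
    rwa [Real.sq_sqrt (by positivity)] at h4
  have hKr1 : K * r ≤ κ := by
    rw [lt_div_iff₀ (by positivity)] at hr2
    linarith
  have hKr2 : K * r ≤ κ / (2 * c) := by
    rw [lt_div_iff₀ (by positivity)] at hr3
    linarith
  have e1 := mul_le_mul_of_nonneg_left hx' hb.le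
  have e2 := mul_le_mul_of_nonneg_left hy' ha.le
  have e3 := mul_le_mul_of_nonneg_right hKr1 (add_nonneg hox hoy)
  have e4 := mul_le_mul_of_nonneg_right hKr2 (sq_nonneg r)
  have e5 := mul_le_mul_of_nonneg_right hκ1 hX
  have e6 := mul_le_mul_of_nonneg_right hκ2 hY
  have e7 := mul_le_mul_of_nonneg_right hκ3 hox
  have e8 := mul_le_mul_of_nonneg_right hκ4 hoy
  have e9 : 2 * (κ / (2 * c)) * r ^ 2 ≤ κ * (X + Y + (ox + oy)) := by
    calc 2 * (κ / (2 * c)) * r ^ 2 ≤ 2 * (κ / (2 * c)) * (c * (X + Y + (ox + oy))) :=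
          mul_le_mul_of_nonneg_left hbound (by positivity)
      _ = κ * (X + Y + (ox + oy)) := by field_simp
  linarith

/-! ### Basin of attraction and step size. -/

theorem tendsto_lyapunov {n m : ℕ} (ε v : ℝ) (xs : Fin n → ℝ) (ys : Fin m → ℝ) :
    Tendsto (lyapunov ε v xs ys) (𝓝 (xs, ys)) (𝓝 0) := by
  have h1 := ((continuousAt_relEnt xs).tendsto.comp (continuous_fst.tendsto (xs, ys))).const_mul
    (1 + ε * v)
  have h2 := ((continuousAt_relEnt ys).tendsto.comp (continuous_snd.tendsto (xs, ys))).const_mul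
    (1 - ε * v)
  have h3 := h1.add h2
  simp only [relEnt_self, mul_zero, add_zero] at h3
  exact h3

theorem le_lyapunov {n m : ℕ} {ε v : ℝ} (hv : |ε * v| < 1) {xs : Fin n → ℝ} {ys : Fin m → ℝ}
    (hx : xs ∈ stdSimplex ℝ (Fin n)) (hy : ys ∈ stdSimplex ℝ (Fin m))
    {p : (Fin n → ℝ) × (Fin m → ℝ)} (hp : p ∈ supportedPairs xs ys) :
    (1 - |ε * v|) / 4 * dist p (xs, ys) ^ 2 ≤ lyapunov ε v xs ys p := by
  obtain ⟨⟨h1, h2⟩, h3, h4⟩ := hp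
  have e1 := norm_sub_sq_le_relEnt hx h1 h3
  have e2 := norm_sub_sq_le_relEnt hy h2 h4
  have c1 : 1 - |ε * v| ≤ 1 + ε * v := by linarith [neg_abs_le (ε * v)]
  have c2 : 1 - |ε * v| ≤ 1 - ε * v := by linarith [le_abs_self (ε * v)]
  have p1 : 0 ≤ relEnt xs p.1 := le_trans (by positivity) e1
  have p2 : 0 ≤ relEnt ys p.2 := le_trans (by positivity) e2
  have c0 : 0 ≤ 1 - |ε * v| := by linarith
  have f1 := mul_le_mul c1 e1 (by positivity) (c0.trans c1)
  have f2 := mul_le_mul c2 e2 (by positivity) (c0.trans c2)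
  have g1 := mul_nonneg (c0.trans c1) p1
  have g2 := mul_nonneg (c0.trans c2) p2
  rw [Prod.dist_eq, dist_eq_norm, dist_eq_norm, lyapunov]
  rcases max_choice ‖p.1 - xs‖ ‖p.2 - ys‖ with h | h <;> rw [h] <;> linarith

theorem supportedPairs_mem_nhdsWithin {n m : ℕ} {xs : Fin n → ℝ} {ys : Fin m → ℝ}
    (hx : xs ∈ stdSimplex ℝ (Fin n)) (hy : ys ∈ stdSimplex ℝ (Fin m)) :
    supportedPairs xs ys ∈ 𝓝[stdSimplex ℝ (Fin n) ×ˢ stdSimplex ℝ (Fin m)] (xs, ys) := by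
  have h1 : ∀ᶠ p in 𝓝 (xs, ys), ∀ i, xs i ≠ 0 → 0 < p.1 i := by
    refine eventually_all.2 fun i => ?_
    by_cases hi : xs i = 0
    · simp [hi]
    have hc : Continuous fun p : (Fin n → ℝ) × (Fin m → ℝ) => p.1 i := by fun_prop
    filter_upwards [hc.continuousAt.eventually
      (lt_mem_nhds (show 0 < (xs, ys).1 i from lt_of_le_of_ne (hx.1 i) (Ne.symm hi)))]
      with p hp _ using hp
  have h2 : ∀ᶠ p in 𝓝 (xs, ys), ∀ j, ys j ≠ 0 → 0 < p.2 j := by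
    refine eventually_all.2 fun i => ?_
    by_cases hi : ys i = 0
    · simp [hi]
    have hc : Continuous fun p : (Fin n → ℝ) × (Fin m → ℝ) => p.2 i := by fun_prop
    filter_upwards [hc.continuousAt.eventually
      (lt_mem_nhds (show 0 < (xs, ys).2 i from lt_of_le_of_ne (hy.1 i) (Ne.symm hi)))]
      with p hp _ using hp
  filter_upwards [self_mem_nhdsWithin, nhdsWithin_le_nhds h1, nhdsWithin_le_nhds h2]
    with p h3 h4 h5 using ⟨h3, h4, h5⟩

theorem RegularPair.exists_basin {n m : ℕ} {A : Matrix (Fin n) (Fin m) ℝ}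
    {xs : Fin n → ℝ} {ys : Fin m → ℝ} {v : ℝ} (hR : RegularPair A xs ys v)
    (hA : WeaklyInvertible (sumZero (Supp ys) : Set (Supp ys → ℝ)) (restrict A xs ys))
    (hAT : WeaklyInvertible (sumZero (Supp xs) : Set (Supp xs → ℝ)) (restrict A xs ys)ᵀ)
    {h ε : ℝ} (hh : 0 < h) (hε : 0 < ε) (hεv : |ε * v| < 1)
    (h1 : h * ε * absSum A ^ 2 ≤ 1 / 32) (h2 : h ≤ ε / 32) :
    ∃ U : Set ((Fin n → ℝ) × (Fin m → ℝ)),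
      U ⊆ stdSimplex ℝ (Fin n) ×ˢ stdSimplex ℝ (Fin m) ∧
      U ∈ 𝓝[stdSimplex ℝ (Fin n) ×ˢ stdSimplex ℝ (Fin m)] (xs, ys) ∧
      ∀ p ∈ U, Tendsto (fun t : ℕ => (step A h ε)^[t] p) atTop (𝓝 (xs, ys)) := by
  obtain ⟨μ, hμ, hdec⟩ := hR.exists_lyapunov_decrease hA hAT hh hε hεv h1 h2
  obtain ⟨U, hUS, hU, hlim⟩ := exists_basin_of_quadratic_lyapunov
    (c := (1 - |ε * v|) / 4) (by linarith) hμ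
    (mapsTo_step A h ε xs ys) (fun q hq => le_lyapunov hεv hR.left_mem hR.right_mem hq)
    ((tendsto_lyapunov ε v xs ys).mono_left nhdsWithin_le_nhds)
    (by filter_upwards [self_mem_nhdsWithin, nhdsWithin_le_nhds hdec] with q h3 h4 using h4 h3)
  refine ⟨U, fun p hp => (hUS hp).1, ?_, hlim⟩
  exact nhdsWithin_le_of_mem (supportedPairs_mem_nhdsWithin hR.left_mem hR.right_mem) hU

/-- Smallness of the step size relative to the coupling `ε = C h ^ (-δ)`. -/
theorem exists_step_bound (S : ℝ) {δ C : ℝ} (hδ0 : 0 ≤ δ) (hδ1 : δ < 1) (hC : 0 < C) :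
    ∃ h₀ : ℝ, 0 < h₀ ∧ ∀ h : ℝ, 0 < h → h < h₀ →
      h * (C * h ^ (-δ)) * S ^ 2 ≤ 1 / 32 ∧ h ≤ C * h ^ (-δ) / 32 := by
  have h1 : Tendsto (fun h : ℝ => C * h ^ (1 - δ) * S ^ 2) (𝓝[>] 0) (𝓝 0) := by
    have h2 : ContinuousAt (fun h : ℝ => h ^ (1 - δ)) 0 :=
      Real.continuousAt_rpow_const 0 _ (Or.inr (by linarith))
    have h3 := ((h2.tendsto.const_mul C).mul_const (S ^ 2)).mono_left
      (nhdsWithin_le_nhds (s := Set.Ioi 0))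
    simpa [Real.zero_rpow (show 1 - δ ≠ 0 by linarith)] using h3
  obtain ⟨s, hs, hs'⟩ := mem_nhdsGT_iff_exists_Ioo_subset.1
    (h1.eventually (gt_mem_nhds (show (0 : ℝ) < 1 / 32 by norm_num)))
  -- `s` makes `C h ^ (1 - δ) S²` small, and `h < 1` gives `ε ≥ C`, so `h < C / 32` suffices for the
  -- second bound.
  refine ⟨min s (min 1 (C / 32)), lt_min hs (lt_min one_pos (by positivity)), fun h hh hlt => ?_⟩
  obtain ⟨hlt1, hlt2, hlt3⟩ : h < s ∧ h < 1 ∧ h < C / 32 := by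
    simpa [lt_min_iff] using hlt
  constructor
  · have h4 : C * h ^ (1 - δ) * S ^ 2 < 1 / 32 := hs' ⟨hh, hlt1⟩
    have h5 : h * (C * h ^ (-δ)) = C * h ^ (1 - δ) := by
      rw [sub_eq_add_neg, Real.rpow_add hh, Real.rpow_one]
      ring
    rw [h5]
    exact h4.le
  · have h6 : 1 ≤ h ^ (-δ) :=
      Real.one_le_rpow_of_pos_of_le_one_of_nonpos hh hlt2.le (by linarith)
    nlinarith

end CMWU

theorem theorem1 {n m : ℕ} (A : Matrix (Fin n) (Fin m) ℝ)
    (xs : Fin n → ℝ) (ys : Fin m → ℝ)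
    (hreg : CMWU.IsRegularNash A xs ys)
    (hA : CMWU.WeaklyInvertible (CMWU.sumZero (CMWU.Supp ys) : Set (CMWU.Supp ys → ℝ))
      (CMWU.restrict A xs ys))
    (hAT : CMWU.WeaklyInvertible (CMWU.sumZero (CMWU.Supp xs) : Set (CMWU.Supp xs → ℝ))
      (CMWU.restrict A xs ys)ᵀ)
    (δ C : ℝ) (hδ0 : 0 ≤ δ) (hδ1 : δ < 1) (hC : 0 < C) :
    ∃ h₀ : ℝ, 0 < h₀ ∧ ∀ h : ℝ, 0 < h → h < h₀ →
      ∀ ε : ℝ, ε = C * h ^ (-δ) →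
        (CMWU.payoff A xs ys ≠ 0 → ε < |(CMWU.payoff A xs ys)⁻¹|) →
        ∃ U : Set ((Fin n → ℝ) × (Fin m → ℝ)),
          U ⊆ stdSimplex ℝ (Fin n) ×ˢ stdSimplex ℝ (Fin m) ∧
          U ∈ 𝓝[stdSimplex ℝ (Fin n) ×ˢ stdSimplex ℝ (Fin m)] (xs, ys) ∧
          ∀ p ∈ U, Tendsto (fun t : ℕ => (CMWU.step A h ε)^[t] p) atTop (𝓝 (xs, ys)) := by
  obtain ⟨h₀, hh₀, hstep⟩ := CMWU.exists_step_bound (CMWU.absSum A) hδ0 hδ1 hC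
  refine ⟨h₀, hh₀, fun h hh hlt ε hε hv => ?_⟩
  have hε0 : 0 < ε := by rw [hε]; positivity
  obtain ⟨h1, h2⟩ := hstep h hh hlt
  rw [← hε] at h1 h2
  refine hreg.regularPair.exists_basin hA hAT hh hε0 ?_ h1 h2
  by_cases h0 : CMWU.payoff A xs ys = 0
  · simp [h0]
  · have h3 := hv h0
    rw [abs_inv, lt_inv_comm₀ hε0 (abs_pos.2 h0), ← one_div, lt_div_iff₀ hε0] at h3
    rw [abs_mul, abs_of_pos hε0, mul_comm]
    exact h3
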